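/- Let $m\ge 1$ be an integer and $h>0$. For $k\ge 0$ let $E_k$ be the Euler (Eulerian) polynomial, i.e. the polynomial with $$\lambda E_k(\lambda)=(1-\lambda)^{k+2}\Big(\lambda\frac{d}{d\lambda}\Big)^{k}\frac{\lambda}{(1-\lambda)^2},$$ and let $G_m[\beta]=\dfrac{(h\beta)^{2m-1}\,\mathrm{sign}(h\beta)}{2\,(2m-1)!}$ for $\beta\in\mathbb Z$. Call $D:\mathbb Z\to\mathbb R$ a discrete analogue of $d^{2m}/dx^{2m}$ (on the lattice of step $h$) if for every $\beta\in\mathbb Z$ the series $\sum_{\gamma\in\mathbb Z}D[\gamma]\,G_m[\beta-\gamma]$ converges absolutely and $$h\sum_{\gamma\in\mathbb Z}D[\gamma]\,G_m[\beta-\gamma]=\delta[\beta],\qquad \delta[0]=1,\quad \delta[\beta]=0\ (\beta\ne0).$$ **Theorem 1.** The polynomial $E_{2m-2}$ has exactly $m-1$ distinct complex roots $\lambda_1,\dots,\lambda_{m-1}$ with $|\lambda_k|<1$; they are real, and $\lambda_k\neq0$, $E_{2m-1}(\lambda_k)\ne0$. There is exactly one discrete analogue $D_m$ of $d^{2m}/dx^{2m}$,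 namely $$ D_m[\beta]=\frac{(2m-1)!}{h^{2m}}\begin{cases} \displaystyle\sum_{k=1}^{m-1}\frac{(1-\lambda_k)^{2m+1}\lambda_k^{|\beta|}}{\lambda_kE_{2m-1}(\lambda_k)}, & |\beta|\ge2,\\[2ex] \displaystyle 1+\sum_{k=1}^{m-1}\frac{(1-\lambda_k)^{2m+1}}{E_{2m-1}(\lambda_k)}, & |\beta|=1,\\[2ex] \displaystyle -2^{2m-1}+\sum_{k=1}^{m-1}\frac{(1-\lambda_k)^{2m+1}}{\lambda_kE_{2m-1}(\lambda_k)}, & \beta=0. \end{cases} $$ -/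

import Mathlib

open Polynomial

/-- The operator `x d/dx` on functions of a real variable. -/
noncomputable def xDeriv (f : ℝ → ℝ) : ℝ → ℝ := fun x => x * deriv f x

/-- The Euler (Eulerian, Euler-Frobenius) polynomial `E_k`, i.e. the polynomial determined by
`x E_k(x) = (1 - x)^(k+2) (x d/dx)^k (x / (1 - x)^2)` for `x ≠ 1`. It is computed here by its
recurrence; `eulerPoly_spec` and `eulerPoly_unique` show that it is that polynomial. -/
noncomputable def eulerPoly : ℕ → ℝ[X]
  | 0 => 1
  | k + 1 => (((k : ℝ[X]) + 1) * X + 1) * eulerPoly k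
      + X * (1 - X) * derivative (eulerPoly k)

/-- The defining identity of the Euler polynomials. -/
theorem eulerPoly_spec (k : ℕ) : ∀ x : ℝ, x ≠ 1 →
    x * (eulerPoly k).eval x = (1 - x) ^ (k + 2) * (xDeriv^[k] (fun y => y / (1 - y) ^ 2)) x := by
  have key : ∀ x : ℝ, x ≠ 1 →
      (xDeriv^[k] (fun y => y / (1 - y) ^ 2)) x
        = x * (eulerPoly k).eval x / (1 - x) ^ (k + 2) := by
    induction k with
    | zero => intro x _; simp [eulerPoly]
    | succ k ih =>
      intro x hx
      have h1 : (1 - x) ≠ 0 := sub_ne_zero.mpr (Ne.symm hx)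
      have hev : (xDeriv^[k] (fun y => y / (1 - y) ^ 2)) =ᶠ[nhds x]
          fun y => y * (eulerPoly k).eval y / (1 - y) ^ (k + 2) := by
        filter_upwards [isOpen_ne.mem_nhds hx] with y hy using ih y hy
      have hd : HasDerivAt (fun y => y * (eulerPoly k).eval y / (1 - y) ^ (k + 2))
          (((1 * (eulerPoly k).eval x + x * (derivative (eulerPoly k)).eval x)
              * (1 - x) ^ (k + 2)
            - x * (eulerPoly k).eval x * (((k + 2 : ℕ) : ℝ) * (1 - x) ^ (k + 2 - 1) * (-1)))
            / ((1 - x) ^ (k + 2)) ^ 2) x :=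
        ((hasDerivAt_id x).mul ((eulerPoly k).hasDerivAt x)).div
          (((hasDerivAt_id x).const_sub 1).pow (k + 2)) (pow_ne_zero _ h1)
      rw [Function.iterate_succ_apply', xDeriv, hev.deriv_eq, hd.deriv]
      simp only [eulerPoly, eval_add, eval_mul, eval_natCast, eval_one, eval_X, eval_sub,
        show k + 2 - 1 = k + 1 from rfl]
      field_simp
      push_cast
      ring
  intro x hx
  have h1 : (1 - x) ≠ 0 := sub_ne_zero.mpr (Ne.symm hx)
  rw [key x hx]
  field_simp

/-- The defining identity determines the Euler polynomials. -/
theorem eulerPoly_unique (k : ℕ) (P : ℝ[X]) (hP : ∀ x : ℝ, x ≠ 1 →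
    x * P.eval x = (1 - x) ^ (k + 2) * (xDeriv^[k] (fun y => y / (1 - y) ^ 2)) x) :
    P = eulerPoly k := by
  refine Polynomial.eq_of_infinite_eval_eq _ _ (Set.Infinite.mono ?_ (Set.Ioi_infinite (1 : ℝ)))
  intro x hx
  have hx1 : (1 : ℝ) < x := hx
  have h0 : x ≠ 0 := by positivity
  exact mul_left_cancel₀ h0 ((hP x hx1.ne').trans (eulerPoly_spec k x hx1.ne').symm)

/-- The real roots of `E_{2m-2}` of absolute value less than one. -/
noncomputable def innerRoots (m : ℕ) : Finset ℝ :=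
  (eulerPoly (2 * m - 2)).roots.toFinset.filter (fun x => |x| < 1)

/-- The lattice function `G_m[β] = (hβ)^(2m-1) sign(hβ) / (2 (2m-1)!)`. -/
noncomputable def latticeG (m : ℕ) (h : ℝ) (β : ℤ) : ℝ :=
  (h * β) ^ (2 * m - 1) * Real.sign (h * β) / (2 * ((2 * m - 1).factorial : ℝ))

/-- `D` is a discrete analogue of `d^{2m}/dx^{2m}` on the lattice of step `h`: the discrete
convolution `(D * G_m)[β] = ∑_γ D[γ] G_m[β - γ]` converges (absolutely) at every `β`, and
`h D * G_m = δ`. -/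
def IsDiscreteAnalogue (m : ℕ) (h : ℝ) (D : ℤ → ℝ) : Prop :=
  ∀ β : ℤ, Summable (fun γ : ℤ => D γ * latticeG m h (β - γ)) ∧
    h * ∑' γ : ℤ, D γ * latticeG m h (β - γ) = if β = 0 then 1 else 0

/-! Let `S` be the unit shift, `g j = j^(2m-1) sign j / 2` and `E = E_{2m-2}`. The generating
function of `j^(2m-1)` over `j > 0` gives `(1-S)^(2m) g = S E(S) δ`, so `u * g = δ` forces `S E(S) u
= (1-S)^(2m) δ`.

`E` is palindromic with `2m-2` simple negative roots, none of modulus one, so they split into pairs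
`l, 1/l`. Hence `S E(S)` is injective on sequences of polynomial growth. Any inverse `u` is bounded,
because the convolution converges at the origin; this gives uniqueness.

For existence, write `E = (X-l)(X-1/l) F_l`. Since `(S-l)(S-1/l) l^|j| = (l-1/l) S δ`, the closed
formula solves the equation once `(1-X)^(2m) = (X^2 - 2^(2m-1) X + 1) E + ∑ A_l (l-1/l) X^2 F_l`,
the sum being over roots with `|l| < 1`. This partial fraction identity is checked by interpolation
at `0` and the roots of `E`. Injectivity then turns the equation for `u` back into `u * g = δ`. -/

/-! ### Coefficients, symmetry and roots of the Euler polynomials -/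

theorem eulerPoly_coeff_zero (k : ℕ) : (eulerPoly k).coeff 0 = 1 := by
  induction k with
  | zero => simp [eulerPoly]
  | succ k ih => simp [eulerPoly, mul_coeff_zero, ih]

theorem eulerPoly_coeff_succ (k j : ℕ) : (eulerPoly (k + 1)).coeff (j + 1) =
    (j + 2) * (eulerPoly k).coeff (j + 1) + (k + 1 - j) * (eulerPoly k).coeff j := by
  have h : eulerPoly (k + 1) = eulerPoly k + C ((k : ℝ) + 1) * (X * eulerPoly k)
      + X * derivative (eulerPoly k) - X * (X * derivative (eulerPoly k)) := by
    simp only [eulerPoly, map_add, map_natCast, map_one]; ring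
  rw [h]
  simp only [coeff_add, coeff_sub, coeff_C_mul, coeff_X_mul]
  cases j with
  | zero => simp [coeff_derivative]; ring
  | succ j => simp [coeff_X_mul, coeff_derivative]; ring

theorem eulerPoly_coeff_eq_zero {k j : ℕ} (h : k < j) : (eulerPoly k).coeff j = 0 := by
  induction k generalizing j with
  | zero => simp [eulerPoly, coeff_one, h.ne']
  | succ k ih =>
    obtain ⟨j, rfl⟩ : ∃ i, j = i + 1 := ⟨j - 1, by omega⟩
    rw [eulerPoly_coeff_succ, ih (by omega), ih (by omega)]; simp

theorem eulerPoly_coeff_self (k : ℕ) : (eulerPoly k).coeff k = 1 := by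
  induction k with
  | zero => simp [eulerPoly]
  | succ k ih => rw [eulerPoly_coeff_succ, ih, eulerPoly_coeff_eq_zero (by omega)]; ring

theorem eulerPoly_natDegree (k : ℕ) : (eulerPoly k).natDegree = k :=
  natDegree_eq_of_le_of_coeff_ne_zero
    (natDegree_le_iff_coeff_eq_zero.2 fun _ h => eulerPoly_coeff_eq_zero h)
    (by simp [eulerPoly_coeff_self])

theorem eulerPoly_monic (k : ℕ) : (eulerPoly k).Monic := by
  rw [Monic, leadingCoeff, eulerPoly_natDegree, eulerPoly_coeff_self]

theorem eulerPoly_nextCoeff (k : ℕ) :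
    (eulerPoly k).nextCoeff = 2 ^ (k + 1) - ((k : ℝ) + 2) := by
  have key (k : ℕ) : (eulerPoly (k + 1)).coeff k = 2 ^ (k + 2) - ((k : ℝ) + 3) := by
    induction k with
    | zero => rw [eulerPoly_coeff_zero]; norm_num
    | succ k ih =>
      rw [eulerPoly_coeff_succ, ih, eulerPoly_coeff_self]; push_cast; ring
  cases k with
  | zero => simp [nextCoeff, eulerPoly_natDegree]
  | succ k =>
    rw [nextCoeff, eulerPoly_natDegree, if_neg k.succ_ne_zero, Nat.add_sub_cancel, key]
    push_cast; ring

theorem eulerPoly_eval_zero (k : ℕ) : (eulerPoly k).eval 0 = 1 := by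
  rw [← coeff_zero_eq_eval_zero, eulerPoly_coeff_zero]

theorem eulerPoly_succ_eval (k : ℕ) (x : ℝ) : (eulerPoly (k + 1)).eval x =
    ((k + 1) * x + 1) * (eulerPoly k).eval x + x * (1 - x) * (derivative (eulerPoly k)).eval x := by
  simp [eulerPoly]

theorem sq_mul_derivative_eval_of_palindromic {P : ℝ[X]} {k : ℕ}
    (hP : ∀ x : ℝ, x ≠ 0 → x ^ k * P.eval x⁻¹ = P.eval x) {x : ℝ} (hx : x ≠ 0) :
    x ^ 2 * (derivative P).eval x =
      k * x * P.eval x - x ^ k * (derivative P).eval x⁻¹ := by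
  have h1 := ((hasDerivAt_pow k x).mul ((P.hasDerivAt x⁻¹).comp x (hasDerivAt_inv hx)))
  have h2 : HasDerivAt (fun y => y ^ k * P.eval y⁻¹) ((derivative P).eval x) x :=
    (P.hasDerivAt x).congr_of_eventuallyEq
      (by filter_upwards [isOpen_ne.mem_nhds hx] with y hy using hP y hy)
  rw [h2.unique h1, ← hP x hx]
  rcases k with _ | k
  · simp; field_simp
  · simp [pow_succ]; field_simp; ring

/-- The recurrence at `1/x` involves `E_k'(1/x)`, which the differentiated symmetry of `E_k`
expresses through `E_k(x)` and `E_k'(x)`. -/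
theorem eulerPoly_palindromic (k : ℕ) {x : ℝ} (hx : x ≠ 0) :
    x ^ k * (eulerPoly k).eval x⁻¹ = (eulerPoly k).eval x := by
  induction k generalizing x with
  | zero => simp [eulerPoly]
  | succ k ih =>
    have h := sq_mul_derivative_eval_of_palindromic (fun y hy => ih hy) hx
    rw [eulerPoly_succ_eval, eulerPoly_succ_eval, ← mul_right_inj' hx]
    have h2 := ih hx
    generalize (derivative (eulerPoly k)).eval x⁻¹ = a at *
    generalize (derivative (eulerPoly k)).eval x = b at *
    generalize (eulerPoly k).eval x = c at *
    have e1 : x ^ k * a = k * x * c - x ^ 2 * b := by linarith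
    have e : x * (x ^ (k + 1) * (((k + 1) * x⁻¹ + 1) * (eulerPoly k).eval x⁻¹
        + x⁻¹ * (1 - x⁻¹) * a)) = x * (k + 1 + x) * (x ^ k * (eulerPoly k).eval x⁻¹)
        + (x - 1) * (x ^ k * a) := by
      field_simp; ring
    rw [e, e1, h2]
    ring

/-- Exactly the `i` factors with `j < i` are negative. The product is the derivative of the nodal
polynomial at `x i`. -/
theorem neg_one_pow_mul_prod_sub_pos {k : ℕ} {x : ℕ → ℝ}
    (hx : ∀ i j, i < j → j < k → x j < x i) {i : ℕ} (hi : i < k) :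
    0 < (-1) ^ i * ∏ j ∈ (Finset.range k).erase i, (x i - x j) := by
  have h : ((-1 : ℝ)) ^ i = ∏ j ∈ (Finset.range k).erase i, (if j < i then -1 else 1) := by
    rw [Finset.prod_ite]
    have : {j ∈ (Finset.range k).erase i | j < i} = Finset.range i := by
      ext j; simp; omega
    simp [this]
  rw [h, ← Finset.prod_mul_distrib]
  refine Finset.prod_pos fun j hj => ?_
  simp only [Finset.mem_erase, Finset.mem_range] at hj
  split_ifs with hji
  · linarith [hx j i hji hi]
  · linarith [hx i j (by omega) hj.2]

theorem Polynomial.Monic.eq_nodal_of_eval_eq_zero {P : ℝ[X]} (hP : P.Monic) {k : ℕ}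
    (hk : P.natDegree = k) {x : ℕ → ℝ} (hinj : Set.InjOn x (Finset.range k))
    (h0 : ∀ i < k, P.eval (x i) = 0) : P = Lagrange.nodal (Finset.range k) x := by
  have hd : P.degree = (Lagrange.nodal (Finset.range k) x).degree := by
    rw [Lagrange.degree_nodal, degree_eq_natDegree hP.ne_zero, hk, Finset.card_range]
  refine eq_of_degree_sub_lt_of_eval_index_eq (Finset.range k) hinj ?_ ?_
  · refine (degree_sub_lt_left hd hP.ne_zero ?_).trans_eq ?_
    · rw [hP.leadingCoeff, Lagrange.nodal_monic.leadingCoeff]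
    · rw [hd, Lagrange.degree_nodal]
  · intro i hi
    rw [h0 i (Finset.mem_range.1 hi), Lagrange.eval_nodal_at_node hi]

/-- Interlacing: at a root `x i` of `E_k` the recurrence leaves `E_{k+1} = x (1-x) E_k'`, whose sign
alternates with `i`. Adding the points `0` and a far negative `N` gives `k+1` sign changes. -/
theorem eulerPoly_exists_strictAnti_roots (k : ℕ) : ∃ x : ℕ → ℝ,
    (∀ i < k, x i < 0 ∧ (eulerPoly k).eval (x i) = 0) ∧ ∀ i j, i < j → j < k → x j < x i := by
  induction k with
  | zero => exact ⟨0, by simp, by simp⟩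
  | succ k ih =>
    obtain ⟨x, hx0, hx⟩ := ih
    have hinj : Set.InjOn x (Finset.range k) := by
      intro i hi j hj hij
      simp only [Finset.coe_range, Set.mem_Iio] at hi hj
      rcases lt_trichotomy i j with h | h | h
      · exact absurd hij (hx i j h hj).ne'
      · exact h
      · exact absurd hij (hx j i h hi).ne
    have hE := (eulerPoly_monic k).eq_nodal_of_eval_eq_zero (eulerPoly_natDegree k) hinj
      fun i hi => (hx0 i hi).2
    have hsign (i : ℕ) (hi : i < k) : 0 < (-1) ^ (i + 1) * (eulerPoly (k + 1)).eval (x i) := by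
      have h1 := neg_one_pow_mul_prod_sub_pos hx hi
      rw [← Lagrange.eval_nodal, ← Lagrange.eval_nodal_derivative_eval_node_eq
        (Finset.mem_range.2 hi), ← hE] at h1
      rw [eulerPoly_succ_eval, (hx0 i hi).2]
      have h2 : 0 < -x i * (1 - x i) := by
        have := (hx0 i hi).1
        nlinarith
      have := mul_pos h1 h2
      rw [pow_succ]; linarith
    -- Take `N = 1/y` with `y` slightly below `0`: palindromicity transfers the sign from
    -- `E_{k+1}(0) = 1`.
    obtain ⟨N, hN0, hNx, hN⟩ : ∃ N < 0, (∀ i < k, N < x i) ∧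
        0 < (-1) ^ (k + 1) * (eulerPoly (k + 1)).eval N := by
      have c1 : ∀ᶠ y in nhdsWithin (0 : ℝ) (Set.Iio 0), 0 < (eulerPoly (k + 1)).eval y := by
        refine nhdsWithin_le_nhds ((eulerPoly (k + 1)).continuous.continuousAt.eventually_const_lt ?_)
        simp [eulerPoly_eval_zero]
      have c2 : ∀ᶠ y in nhdsWithin (0 : ℝ) (Set.Iio 0), ∀ i ∈ Finset.range k, y⁻¹ < x i :=
        (Filter.eventually_all_finset _).2 fun i _ =>
          tendsto_inv_nhdsLT_zero.eventually (Filter.eventually_lt_atBot (x i))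
      obtain ⟨y, hy1, hy2, hy⟩ := (c1.and (c2.and self_mem_nhdsWithin)).exists
      have hy : y < 0 := hy
      refine ⟨y⁻¹, inv_lt_zero.2 hy, fun i hi => hy2 i (Finset.mem_range.2 hi), ?_⟩
      have h1 := eulerPoly_palindromic (k + 1) hy.ne
      rw [← h1] at hy1
      have h2 : 0 < ((-y) ^ (k + 1))⁻¹ := by have := neg_pos.2 hy; positivity
      have h3 := mul_pos hy1 h2
      have h4 : (-1 : ℝ) ^ (k + 1) = y ^ (k + 1) * ((-y) ^ (k + 1))⁻¹ := by
        rw [neg_pow y, mul_inv, ← inv_pow, inv_neg_one]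
        field_simp [hy.ne]
      rw [h4]; linarith
    let y : ℕ → ℝ := fun i => if i = 0 then 0 else if i ≤ k then x (i - 1) else N
    have hy (i : ℕ) (hi : i < k + 1) : y (i + 1) < y i := by
      rcases i with _ | i
      · by_cases h : 1 ≤ k
        · simpa [y, h] using (hx0 0 h).1
        · simpa [y, h] using hN0
      · by_cases h : i + 2 ≤ k
        · have : i + 1 ≤ k := by omega
          simpa [y, h, this] using hx i (i + 1) (by omega) (by omega)
        · have : i + 1 ≤ k := by omega
          simpa [y, h, this] using hNx i (by omega)
    have hys (i : ℕ) (hi : i ≤ k + 1) : 0 < (-1) ^ i * (eulerPoly (k + 1)).eval (y i) := by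
      rcases i with _ | i
      · simp [y, eulerPoly_eval_zero]
      · by_cases h : i + 1 ≤ k
        · simpa [y, h] using hsign i h
        · obtain rfl : i = k := by omega
          simpa [y] using hN
    have hz (i : ℕ) : ∃ z, i < k + 1 → y (i + 1) < z ∧ z < y i ∧
        (eulerPoly (k + 1)).eval z = 0 := by
      by_cases hi : i < k + 1
      · have h1 := hys i hi.le
        have h2 := hys (i + 1) hi
        have hc : ContinuousOn (fun t => (-1) ^ i * (eulerPoly (k + 1)).eval t)
          (Set.Icc (y (i + 1)) (y i)) := by fun_prop
        obtain ⟨z, hz, hz0⟩ := intermediate_value_Ioo (hy i hi).le hc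
          (show (0 : ℝ) ∈ Set.Ioo _ _ from ⟨by rw [pow_succ] at h2; linarith, h1⟩)
        exact ⟨z, fun _ => ⟨hz.1, hz.2, by simpa using hz0⟩⟩
      · exact ⟨0, fun h => absurd h hi⟩
    choose z hz using hz
    have hya (i j : ℕ) (hij : i ≤ j) (hj : j ≤ k + 1) : y j ≤ y i := by
      induction j, hij using Nat.le_induction with
      | base => exact le_rfl
      | succ j hij ih => exact (hy j (by omega)).le.trans (ih (by omega))
    refine ⟨z, fun i hi => ⟨(hz i hi).2.1.trans_le ?_, (hz i hi).2.2⟩, fun i j hij hj => ?_⟩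
    · simpa [y] using hya 0 i (by omega) hi.le
    · exact ((hz j hj).2.1.trans_le (hya (i + 1) j hij hj.le)).trans (hz i (by omega)).1

theorem eulerPoly_eq_prod (k : ℕ) : ∃ s : Finset ℝ, s.card = k ∧ (∀ x ∈ s, x < 0) ∧
    eulerPoly k = ∏ x ∈ s, (X - C x) := by
  obtain ⟨x, hx0, hx⟩ := eulerPoly_exists_strictAnti_roots k
  have hinj : Set.InjOn x (Finset.range k) := by
    intro i hi j hj hij
    simp only [Finset.coe_range, Set.mem_Iio] at hi hj
    rcases lt_trichotomy i j with h | h | h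
    · exact absurd hij (hx i j h hj).ne'
    · exact h
    · exact absurd hij (hx j i h hi).ne
  refine ⟨(Finset.range k).image x, ?_, ?_, ?_⟩
  · rw [Finset.card_image_of_injOn hinj, Finset.card_range]
  · simpa using fun i hi => (hx0 i hi).1
  · rw [Finset.prod_image hinj]
    exact (eulerPoly_monic k).eq_nodal_of_eval_eq_zero (eulerPoly_natDegree k) hinj
      fun i hi => (hx0 i hi).2

/-! ### Shift calculus on bilateral sequences -/

/-- The shift `u ↦ u(· - 1)` on bilateral sequences. -/
noncomputable def seqShift : Module.End ℝ (ℤ → ℝ) := LinearMap.funLeft ℝ ℝ fun j => j - 1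

/-- Multiplication of a bilateral sequence by its index. -/
noncomputable def seqIndexMul : Module.End ℝ (ℤ → ℝ) where
  toFun u := fun j => j * u j
  map_add' u v := by ext j; simp [mul_add]
  map_smul' c u := by ext j; simp; ring

/-- The unit impulse at the origin. -/
noncomputable def seqDelta : ℤ → ℝ := fun j => if j = 0 then 1 else 0

@[simp] theorem seqShift_apply (u : ℤ → ℝ) (j : ℤ) : seqShift u j = u (j - 1) := rfl

@[simp] theorem seqIndexMul_apply (u : ℤ → ℝ) (j : ℤ) : seqIndexMul u j = j * u j := rfl

theorem seqShift_pow_apply (n : ℕ) (u : ℤ → ℝ) (j : ℤ) : (seqShift ^ n) u j = u (j - n) := by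
  induction n generalizing j with
  | zero => simp
  | succ n ih => rw [pow_succ', Module.End.mul_apply, seqShift_apply, ih]; push_cast; congr 1; ring

theorem aeval_seqShift_apply (P : ℝ[X]) (u : ℤ → ℝ) (j : ℤ) :
    aeval seqShift P u j = ∑ i ∈ Finset.range (P.natDegree + 1), P.coeff i * u (j - i) := by
  simp [aeval_eq_sum_range, seqShift_pow_apply, Finset.sum_apply]

theorem aeval_mul_seqShift (P Q : ℝ[X]) (u : ℤ → ℝ) :
    aeval seqShift (P * Q) u = aeval seqShift P (aeval seqShift Q u) := by
  rw [map_mul, Module.End.mul_apply]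

/-- Leibniz rule: multiplication by the index acts as `X d/dX` on generating functions. -/
theorem seqIndexMul_aeval (P : ℝ[X]) (u : ℤ → ℝ) :
    seqIndexMul (aeval seqShift P u) =
      aeval seqShift P (seqIndexMul u) + aeval seqShift (X * derivative P) u := by
  induction P using Polynomial.induction_on' with
  | add p q hp hq =>
    simp only [map_add, LinearMap.add_apply, hp, hq, mul_add]; abel
  | monomial n a =>
    ext j
    rw [derivative_monomial, X_mul_monomial]
    rcases n with _ | n
    · simp; ring
    · simp [aeval_monomial, seqShift_pow_apply]; ring

theorem aeval_seqShift_seqIndexMul (P : ℝ[X]) (u : ℤ → ℝ) :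
    aeval seqShift P (seqIndexMul u) =
      seqIndexMul (aeval seqShift P u) - aeval seqShift (X * derivative P) u := by
  rw [seqIndexMul_aeval, add_sub_cancel_right]

theorem X_mul_derivative_one_sub_X_pow (n : ℕ) :
    X * derivative ((1 - X : ℝ[X]) ^ (n + 1)) = -((n + 1 : ℝ[X]) * X * (1 - X) ^ n) := by
  rw [derivative_pow_succ]; simp; ring

theorem one_sub_shift_pow_monomial (k : ℕ) :
    aeval seqShift ((1 - X : ℝ[X]) ^ (k + 1)) (fun j : ℤ => (j : ℝ) ^ k) = 0 := by
  induction k with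
  | zero => ext j; simp
  | succ k ih =>
    have h : (fun j : ℤ => (j : ℝ) ^ (k + 1)) = seqIndexMul fun j => (j : ℝ) ^ k := by
      ext j; simp [pow_succ']
    have h2 : aeval seqShift ((1 - X : ℝ[X]) ^ (k + 1 + 1)) (fun j : ℤ => (j : ℝ) ^ k) = 0 := by
      rw [pow_succ', aeval_mul_seqShift, ih, map_zero]
    rw [h, aeval_seqShift_seqIndexMul, h2, X_mul_derivative_one_sub_X_pow, map_neg,
      LinearMap.neg_apply, aeval_mul_seqShift, ih]
    simp

theorem seqIndexMul_seqDelta : seqIndexMul seqDelta = 0 := by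
  ext j; simp [seqDelta]

/-- This is `∑_{j>0} j^(k+1) X^j = X E_k / (1-X)^(k+2)` in operator form. Commuting the index past
`(1-S)^(k+2)` reproduces the recurrence of `E_k`, as the index kills `δ`. -/
theorem one_sub_shift_pow_posMonomial (k : ℕ) :
    aeval seqShift ((1 - X : ℝ[X]) ^ (k + 2)) (fun j : ℤ => if 0 < j then (j : ℝ) ^ (k + 1) else 0) =
      aeval seqShift (X * eulerPoly k) seqDelta := by
  induction k with
  | zero =>
    have h : (1 - X : ℝ[X]) ^ 2 = 1 - C 2 * X + X ^ 2 := by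
      simp only [map_ofNat]; ring
    ext j
    simp only [zero_add, h, eulerPoly, mul_one, map_add, map_sub, map_mul, map_one, map_pow,
      aeval_X, aeval_C, LinearMap.add_apply, LinearMap.sub_apply, Module.End.mul_apply,
      Pi.add_apply, Pi.sub_apply, seqShift_pow_apply, Module.End.one_apply, seqShift_apply,
      seqDelta, Module.algebraMap_end_apply, Pi.smul_apply, smul_eq_mul, pow_one]
    rcases lt_trichotomy j 1 with h | h | h
    · simp [show ¬ 0 < j by omega, show ¬ 1 < j by omega, show ¬ 2 < j by omega,
        show ¬ j - 1 = 0 by omega]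
    · simp [h]
    · rcases eq_or_ne j 2 with h2 | h2
      · simp [h2]
      · simp [show 0 < j by omega, show 1 < j by omega, show 2 < j by omega,
          show ¬ j - 1 = 0 by omega]
        ring
  | succ k ih =>
    set p : ℤ → ℝ := fun j : ℤ => if 0 < j then (j : ℝ) ^ (k + 1) else 0 with hp
    have h : (fun j : ℤ => if 0 < j then (j : ℝ) ^ (k + 1 + 1) else 0) = seqIndexMul p := by
      ext j; simp [hp, pow_succ']
    have h1 : aeval seqShift ((1 - X : ℝ[X]) ^ (k + 1 + 2)) (seqIndexMul p) =
        aeval seqShift (1 - X : ℝ[X]) (seqIndexMul (aeval seqShift ((1 - X : ℝ[X]) ^ (k + 2)) p))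
        + aeval seqShift ((k + 2 : ℝ[X]) * X) (aeval seqShift ((1 - X : ℝ[X]) ^ (k + 2)) p) := by
      rw [show (1 - X : ℝ[X]) ^ (k + 1 + 2) = (1 - X) * (1 - X) ^ (k + 2) by ring,
        aeval_mul_seqShift, aeval_seqShift_seqIndexMul, map_sub, sub_eq_add_neg,
        ← aeval_mul_seqShift, ← aeval_mul_seqShift, X_mul_derivative_one_sub_X_pow,
        ← LinearMap.neg_apply, ← map_neg]
      congr 3
      push_cast; ring
    rw [h, h1, ih, seqIndexMul_aeval, seqIndexMul_seqDelta, map_zero, zero_add,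
      ← aeval_mul_seqShift, ← aeval_mul_seqShift, ← LinearMap.add_apply, ← map_add]
    congr 2
    simp [eulerPoly]; ring

/-- The sequence `j ^ (2m-1) sign j / 2`. -/
noncomputable def seqSignMonomial (m : ℕ) : ℤ → ℝ :=
  fun j => (j : ℝ) ^ (2 * m - 1) * Real.sign j / 2

/-- The sequence is the one-sided monomial minus half the full monomial, and `(1-S)^(2m)`
annihilates the latter. -/
theorem one_sub_shift_pow_seqSignMonomial {m : ℕ} (hm : 1 ≤ m) :
    aeval seqShift ((1 - X : ℝ[X]) ^ (2 * m)) (seqSignMonomial m) =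
      aeval seqShift (X * eulerPoly (2 * m - 2)) seqDelta := by
  have h1 := one_sub_shift_pow_posMonomial (2 * m - 2)
  have h2 := one_sub_shift_pow_monomial (2 * m - 1)
  rw [show 2 * m - 2 + 2 = 2 * m by omega, show 2 * m - 2 + 1 = 2 * m - 1 by omega] at h1
  rw [show 2 * m - 1 + 1 = 2 * m by omega] at h2
  have h : seqSignMonomial m = (fun j : ℤ => if 0 < j then (j : ℝ) ^ (2 * m - 1) else 0)
      - (1 / 2 : ℝ) • fun j : ℤ => (j : ℝ) ^ (2 * m - 1) := by
    ext j
    rcases lt_trichotomy j 0 with h | h | h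
    · have : (j : ℝ) < 0 := by exact_mod_cast h
      simp [seqSignMonomial, Real.sign_of_neg this, h.not_gt]; ring
    · simp [seqSignMonomial, h, show 2 * m - 1 ≠ 0 by omega]
    · have : 0 < (j : ℝ) := by exact_mod_cast h
      simp [seqSignMonomial, Real.sign_of_pos this, h]; ring
  rw [h, map_sub, map_smul, h1, h2, smul_zero, sub_zero]

/-! ### Polynomial growth and injectivity of shift polynomials -/

/-- `u` grows at most like `|j| ^ n`. -/
def HasPolyGrowth (n : ℕ) (u : ℤ → ℝ) : Prop := ∃ C : ℝ, ∀ j : ℤ, |u j| ≤ C * (1 + |(j : ℝ)|) ^ n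

theorem HasPolyGrowth.sub {n : ℕ} {u v : ℤ → ℝ} (hu : HasPolyGrowth n u)
    (hv : HasPolyGrowth n v) : HasPolyGrowth n (u - v) := by
  obtain ⟨A, hA⟩ := hu
  obtain ⟨B, hB⟩ := hv
  refine ⟨A + B, fun j => ?_⟩
  rw [add_mul]
  exact (abs_sub _ _).trans (add_le_add (hA j) (hB j))

theorem HasPolyGrowth.smul {n : ℕ} {u : ℤ → ℝ} (hu : HasPolyGrowth n u) (c : ℝ) :
    HasPolyGrowth n (c • u) := by
  obtain ⟨A, hA⟩ := hu
  refine ⟨|c| * A, fun j => ?_⟩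
  rw [Pi.smul_apply, smul_eq_mul, abs_mul, mul_assoc]
  exact mul_le_mul_of_nonneg_left (hA j) (abs_nonneg c)

theorem one_add_abs_sub_le (a b : ℝ) : 1 + |a - b| ≤ (1 + |a|) * (1 + |b|) := by
  nlinarith [abs_sub a b, abs_nonneg a, abs_nonneg b, mul_nonneg (abs_nonneg a) (abs_nonneg b)]

theorem HasPolyGrowth.comp_sub {n : ℕ} {u : ℤ → ℝ} (hu : HasPolyGrowth n u) (a : ℤ) :
    HasPolyGrowth n fun j => u (j - a) := by
  obtain ⟨A, hA⟩ := hu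
  have hA0 : 0 ≤ A := by simpa using (abs_nonneg _).trans (hA 0)
  refine ⟨A * (1 + |(a : ℝ)|) ^ n, fun j => (hA _).trans ?_⟩
  rw [mul_assoc, ← mul_pow]
  push_cast
  gcongr
  rw [mul_comm]
  exact one_add_abs_sub_le _ _

theorem tendsto_geom_mul_poly {r : ℝ} (hr0 : 0 ≤ r) (hr : r < 1) (A : ℝ) (n : ℕ) :
    Filter.Tendsto (fun i : ℕ => r ^ i * (A * (1 + (i : ℝ)) ^ n)) Filter.atTop (nhds 0) := by
  rcases hr0.eq_or_lt with rfl | h0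
  · refine tendsto_const_nhds.congr' ?_
    filter_upwards [Filter.eventually_ne_atTop 0] with i hi
    simp [hi]
  · have h := (tendsto_pow_const_mul_const_pow_of_abs_lt_one n
      (show |r| < 1 by rwa [abs_of_nonneg hr0])).comp (Filter.tendsto_add_atTop_nat 1)
    have := h.const_mul (A / r)
    rw [mul_zero] at this
    refine this.congr fun i => ?_
    simp only [Function.comp, Nat.cast_add, Nat.cast_one, pow_succ]
    field_simp
    ring

/-- Such a `u` is geometric: iterating rightwards if `|ρ| < 1`, leftwards if `|ρ| > 1`, bounds `u k`
by a decaying exponential times a polynomial. -/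
theorem HasPolyGrowth.eq_zero_of_shift_eq_smul {n : ℕ} {u : ℤ → ℝ} (hu : HasPolyGrowth n u)
    {ρ : ℝ} (hρ : |ρ| ≠ 1) (h : ∀ j, u (j - 1) = ρ * u j) : u = 0 := by
  ext k
  obtain ⟨A, hA⟩ := hu.comp_sub (-k)
  obtain ⟨B, hB⟩ : HasPolyGrowth n fun j => u (k - j) := by
    refine ⟨A, fun j => ?_⟩
    have := hA (-j)
    simp only [show -j - -k = k - j by ring] at this
    simpa using this
  rw [Pi.zero_apply, ← abs_nonpos_iff]
  rcases hρ.lt_or_gt with h1 | h1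
  · have hit (i : ℕ) : u k = ρ ^ i * u (k + i) := by
      induction i with
      | zero => simp
      | succ i ih =>
        rw [ih, pow_succ, mul_assoc, ← h]; push_cast; congr 2; ring
    refine ge_of_tendsto' (tendsto_geom_mul_poly (abs_nonneg ρ) h1 A n) fun i => ?_
    rw [hit i, abs_mul, abs_pow]
    have := hA i
    simp only [show (i : ℤ) - -k = k + i by ring] at this
    gcongr
    simpa using this
  · have hρ0 : ρ ≠ 0 := by rintro rfl; simp at h1; linarith
    have hit (i : ℕ) : u k = ρ⁻¹ ^ i * u (k - i) := by
      induction i with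
      | zero => simp
      | succ i ih =>
        rw [ih, pow_succ, mul_assoc]
        have := h (k - i)
        rw [show k - (i + 1 : ℕ) = k - i - 1 by push_cast; ring, this]
        field_simp
    refine ge_of_tendsto' (tendsto_geom_mul_poly (abs_nonneg ρ⁻¹)
      (by rw [abs_inv]; exact inv_lt_one_of_one_lt₀ h1) B n) fun i => ?_
    rw [hit i, abs_mul, abs_pow]
    have := hB i
    gcongr
    simpa using this

theorem HasPolyGrowth.eq_zero_of_aeval_prod_eq_zero {n : ℕ} {s : Finset ℝ}
    (hs : ∀ ρ ∈ s, |ρ| ≠ 1) {u : ℤ → ℝ} (hu : HasPolyGrowth n u)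
    (h : aeval seqShift (∏ ρ ∈ s, (X - C ρ)) u = 0) : u = 0 := by
  induction s using Finset.induction_on generalizing u with
  | empty => simpa using h
  | insert ρ s hρ ih =>
    rw [Finset.prod_insert hρ, mul_comm, aeval_mul_seqShift] at h
    have e : aeval seqShift (X - C ρ) u = (fun j => u (j - 1)) - ρ • u := by
      ext j; simp
    have h1 := ih (fun x hx => hs x (Finset.mem_insert_of_mem hx))
      (e ▸ (hu.comp_sub 1).sub (hu.smul ρ)) h
    refine hu.eq_zero_of_shift_eq_smul (hs ρ (Finset.mem_insert_self _ _)) fun j => ?_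
    have := congrFun h1 j
    rw [e] at this
    simpa [sub_eq_zero] using this

/-! ### Convolution -/

/-- The convolution of bilateral sequences. -/
noncomputable def seqConv (u v : ℤ → ℝ) : ℤ → ℝ := fun j => ∑' i, u i * v (j - i)

theorem seqConv_comm (u v : ℤ → ℝ) : seqConv u v = seqConv v u := by
  ext j
  unfold seqConv
  rw [← (Equiv.subLeft j).tsum_eq]
  refine tsum_congr fun i => ?_
  simp [mul_comm]

theorem seqConv_seqDelta (u : ℤ → ℝ) : seqConv u seqDelta = u := by
  ext j
  unfold seqConv
  rw [tsum_eq_single j]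
  · simp [seqDelta]
  · intro i hi
    simp [seqDelta, sub_eq_zero, hi.symm]

theorem aeval_seqShift_seqConv (P : ℝ[X]) {u v : ℤ → ℝ}
    (h : ∀ j, Summable fun i => u i * v (j - i)) :
    aeval seqShift P (seqConv u v) = seqConv u (aeval seqShift P v) := by
  ext j
  rw [aeval_seqShift_apply]
  unfold seqConv
  simp_rw [aeval_seqShift_apply, Finset.mul_sum]
  rw [Summable.tsum_finsetSum fun i _ => ?_]
  · refine Finset.sum_congr rfl fun i _ => ?_
    rw [← tsum_mul_left]
    refine tsum_congr fun l => ?_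
    rw [show j - i - l = j - l - i by ring]; ring
  · refine ((h (j - i)).mul_left (P.coeff i)).congr fun l => ?_
    rw [show j - i - l = j - l - i by ring]; ring

theorem summable_mul_comp_sub_comm {u v : ℤ → ℝ} {j : ℤ}
    (h : Summable fun i => u i * v (j - i)) : Summable fun i => v i * u (j - i) := by
  rw [← (Equiv.subLeft j).summable_iff]
  refine h.congr fun i => ?_
  simp [mul_comm]

/-- The weight is submultiplicative, `1 + |j-i| ≤ (1+|j|)(1+|i|)`, so the bound on `v (j-i)`
separates into a factor in `j` and a summable weight in `i`. -/
theorem hasPolyGrowth_seqConv {n : ℕ} {u v : ℤ → ℝ}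
    (hu : Summable fun i : ℤ => |u i| * (1 + |(i : ℝ)|) ^ n) (hv : HasPolyGrowth n v) :
    (∀ j, Summable fun i => u i * v (j - i)) ∧ HasPolyGrowth n (seqConv u v) := by
  obtain ⟨A, hA⟩ := hv
  have hA0 : 0 ≤ A := by simpa using (abs_nonneg _).trans (hA 0)
  have hb (j i : ℤ) : ‖u i * v (j - i)‖ ≤
      A * (1 + |(j : ℝ)|) ^ n * (|u i| * (1 + |(i : ℝ)|) ^ n) := by
    rw [Real.norm_eq_abs, abs_mul]
    calc |u i| * |v (j - i)| ≤ |u i| * (A * ((1 + |(j : ℝ)|) * (1 + |(i : ℝ)|)) ^ n) := by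
          refine mul_le_mul_of_nonneg_left ((hA _).trans ?_) (abs_nonneg _)
          push_cast
          gcongr
          exact one_add_abs_sub_le _ _
      _ = _ := by rw [mul_pow]; ring
  refine ⟨fun j => .of_norm_bounded (hu.mul_left _) (hb j),
    A * ∑' i : ℤ, |u i| * (1 + |(i : ℝ)|) ^ n, fun j => ?_⟩
  have := tsum_of_norm_bounded (hu.mul_left (A * (1 + |(j : ℝ)|) ^ n)).hasSum (hb j)
  rw [tsum_mul_left] at this
  rw [← Real.norm_eq_abs]
  exact this.trans_eq (by ring)

/-- On either side of the origin `l^|j|` solves the recurrence with characteristic roots `l, 1/l`;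
the defect sits at `j = 1` only. -/
theorem aeval_quadratic_geometric {l : ℝ} (hl : l ≠ 0) :
    aeval seqShift ((X - C l) * (X - C l⁻¹)) (fun j => l ^ j.natAbs) =
      aeval seqShift (C (l - l⁻¹) * X) seqDelta := by
  ext j
  have e : (X - C l) * (X - C l⁻¹) = X ^ 2 - C (l + l⁻¹) * X + 1 := by
    have : C l * C l⁻¹ = 1 := by rw [← C_mul, mul_inv_cancel₀ hl, C_1]
    rw [C_add]; linear_combination this
  simp only [e, map_add, map_sub, map_mul, map_one, map_pow,
    aeval_X, aeval_C, LinearMap.add_apply, LinearMap.sub_apply, Module.End.mul_apply,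
    Pi.add_apply, Pi.sub_apply, seqShift_pow_apply, Module.End.one_apply, seqShift_apply,
    seqDelta, Module.algebraMap_end_apply, Pi.smul_apply, smul_eq_mul]
  rcases lt_trichotomy j 1 with h | h | h
  · obtain ⟨i, rfl⟩ : ∃ i : ℕ, j = -i := ⟨j.natAbs, by omega⟩
    rw [show (-(i : ℤ) - (2 : ℕ)).natAbs = i + 2 by omega,
      show (-(i : ℤ) - 1).natAbs = i + 1 by omega, show (-(i : ℤ)).natAbs = i by omega,
      if_neg (by omega)]
    field_simp
    ring
  · subst h; simp; ring
  · obtain ⟨i, rfl⟩ : ∃ i : ℕ, j = i + 2 := ⟨(j - 2).natAbs, by omega⟩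
    rw [show ((i : ℤ) + 2 - (2 : ℕ)).natAbs = i by omega,
      show ((i : ℤ) + 2 - 1).natAbs = i + 1 by omega, show ((i : ℤ) + 2).natAbs = i + 2 by omega,
      if_neg (by omega)]
    field_simp
    ring

theorem summable_mul_seqDelta (u : ℤ → ℝ) (j : ℤ) :
    Summable fun i => u i * seqDelta (j - i) := by
  refine summable_of_ne_finset_zero (s := {j}) fun i hi => ?_
  have : j - i ≠ 0 := by simpa [sub_eq_zero, eq_comm] using hi
  simp [seqDelta, this]

/-! ### Reciprocal root pairs and the partial fraction identity -/

theorem eulerPoly_two_mul_sub_two_eq_prod (m : ℕ) : ∃ s : Finset ℝ, s.card = 2 * m - 2 ∧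
    eulerPoly (2 * m - 2) = ∏ x ∈ s, (X - C x) ∧
    (∀ x ∈ s, x < 0 ∧ x⁻¹ ∈ s ∧ |x| ≠ 1) ∧
    innerRoots m = s.filter (fun x => |x| < 1) ∧ (innerRoots m).card = m - 1 := by
  obtain ⟨s, hcard, hneg, hE⟩ := eulerPoly_eq_prod (2 * m - 2)
  have hmem (x : ℝ) : x ∈ s ↔ (eulerPoly (2 * m - 2)).eval x = 0 := by
    rw [hE, eval_prod, Finset.prod_eq_zero_iff]
    simp [sub_eq_zero]
  have hinv (x : ℝ) (hx : x ∈ s) : x⁻¹ ∈ s := by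
    rw [hmem] at hx ⊢
    have h0 : x ≠ 0 := fun h => by rw [h, eulerPoly_eval_zero] at hx; exact one_ne_zero hx
    rw [← eulerPoly_palindromic _ h0] at hx
    exact (mul_eq_zero.1 hx).resolve_left (pow_ne_zero _ h0)
  have hinner : innerRoots m = s.filter (fun x => |x| < 1) := by
    rw [innerRoots, hE, roots_prod_X_sub_C, Finset.val_toFinset]
  have hbij : (s.filter fun x => |x| < 1).card = (s.filter fun x => 1 < |x|).card := by
    refine Finset.card_bij (fun x _ => x⁻¹) ?_ (fun _ _ _ _ h => inv_injective h) ?_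
    · intro x hx
      rw [Finset.mem_filter] at hx ⊢
      exact ⟨hinv x hx.1, by
        rw [abs_inv]; exact (one_lt_inv₀ (abs_pos.2 (hneg x hx.1).ne)).2 hx.2⟩
    · intro x hx
      rw [Finset.mem_filter] at hx
      exact ⟨x⁻¹, Finset.mem_filter.2 ⟨hinv x hx.1, by
        rw [abs_inv]; exact inv_lt_one_of_one_lt₀ hx.2⟩, inv_inv x⟩
  have hone : (s.filter fun x => |x| = 1) ⊆ {-1} := by
    intro x hx
    rw [Finset.mem_filter] at hx
    rw [Finset.mem_singleton, ← hx.2, abs_of_neg (hneg x hx.1), neg_neg]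
  have hone' := Finset.card_le_card hone
  rw [Finset.card_singleton] at hone'
  have hsum : s.card = (s.filter fun x => |x| < 1).card + (s.filter fun x => 1 < |x|).card
      + (s.filter fun x => |x| = 1).card := by
    rw [← Finset.card_union_of_disjoint, ← Finset.card_union_of_disjoint]
    · congr 1
      ext x
      simp only [Finset.mem_union, Finset.mem_filter]
      have := lt_trichotomy |x| 1
      tauto
    · rw [Finset.disjoint_left]
      intro x hx h
      simp only [Finset.mem_union, Finset.mem_filter] at hx h
      rcases hx with hx | hx <;> linarith [hx.2, h.2]
    · rw [Finset.disjoint_left]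
      intro x hx h
      simp only [Finset.mem_filter] at hx h
      linarith [hx.2, h.2]
  -- Parity: inversion matches inner with outer roots and the total `2m-2` is even, so the lone
  -- candidate `-1` is not a root.
  have hzero : (s.filter fun x => |x| = 1).card = 0 := by omega
  refine ⟨s, hcard, hE, fun x hx => ⟨hneg x hx, hinv x hx, fun h => ?_⟩, hinner, ?_⟩
  · rw [Finset.card_eq_zero] at hzero
    exact Finset.notMem_empty x (hzero ▸ Finset.mem_filter.2 ⟨hx, h⟩)
  · rw [hinner]; omega

/-- The amplitude of the geometric term `x ^ |β|` in the discrete analogue. -/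
noncomputable def analogueAmplitude (m : ℕ) (x : ℝ) : ℝ :=
  (1 - x) ^ (2 * m + 1) / (x * (eulerPoly (2 * m - 1)).eval x)

/-- The discrete analogue of `d^{2m}/dx^{2m}` up to normalization. -/
noncomputable def analogueSeq (m : ℕ) : ℤ → ℝ := fun j =>
  (if |j| = 1 then 1 else if j = 0 then -(2 : ℝ) ^ (2 * m - 1) else 0) +
    ∑ x ∈ innerRoots m, analogueAmplitude m x * x ^ j.natAbs

/-- `F` collects the roots other than `l, 1/l`. As `E'(l) = (l-1/l) F(l)`, the recurrence evaluates
`E_{2m-1}(l)`, and differentiated palindromicity relates `F(l)` to `F(1/l)`. -/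
theorem exists_cofactor {m : ℕ} (hm : 1 ≤ m) {l : ℝ} (hl : l ∈ innerRoots m) : ∃ F : ℝ[X],
    eulerPoly (2 * m - 2) = (X - C l) * (X - C l⁻¹) * F ∧ F.natDegree + 4 = 2 * m ∧
    l < 0 ∧ -1 < l ∧ F.eval l ≠ 0 ∧ l ^ 2 * F.eval l = l ^ (2 * m - 2) * F.eval l⁻¹ ∧
    (eulerPoly (2 * m - 1)).eval l = l * (1 - l) * ((l - l⁻¹) * F.eval l) := by
  obtain ⟨s, hcard, hE, hs, hinner, -⟩ := eulerPoly_two_mul_sub_two_eq_prod m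
  rw [hinner, Finset.mem_filter] at hl
  obtain ⟨hls, hl1⟩ := hl
  obtain ⟨hl0, hli, -⟩ := hs l hls
  have hl2 : -1 < l := by rw [abs_of_neg hl0] at hl1; linarith
  have hlt : l⁻¹ < l := by
    refine lt_of_lt_of_le ?_ hl2.le
    rw [inv_lt_of_neg hl0 (by norm_num)]
    simpa using hl2
  have hli' : l⁻¹ ∈ s.erase l := Finset.mem_erase.2 ⟨hlt.ne, hli⟩
  set F : ℝ[X] := ∏ x ∈ (s.erase l).erase l⁻¹, (X - C x) with hF
  have hEF : eulerPoly (2 * m - 2) = (X - C l) * (X - C l⁻¹) * F := by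
    rw [hE, mul_assoc, hF, Finset.mul_prod_erase _ (fun x => X - C x) hli',
      Finset.mul_prod_erase _ (fun x => X - C x) hls]
  have hd (x : ℝ) : (derivative (eulerPoly (2 * m - 2))).eval x =
      (x - l⁻¹) * F.eval x + (x - l) * F.eval x
        + (x - l) * (x - l⁻¹) * (derivative F).eval x := by
    rw [hEF]; simp; ring
  have hroot : (eulerPoly (2 * m - 2)).eval l = 0 := by rw [hEF]; simp
  refine ⟨F, hEF, ?_, hl0, hl2, ?_, ?_, ?_⟩
  · have h1 : (s.erase l).card = s.card - 1 := Finset.card_erase_of_mem hls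
    have h2 := Finset.card_erase_of_mem hli'
    have h3 : 0 < (s.erase l).card := Finset.card_pos.2 ⟨_, hli'⟩
    rw [hF, natDegree_prod_of_monic _ _ fun x _ => monic_X_sub_C x]
    simp only [natDegree_X_sub_C, Finset.sum_const, smul_eq_mul, mul_one]
    omega
  · rw [hF, eval_prod, Finset.prod_ne_zero_iff]
    intro x hx
    simp only [Finset.mem_erase] at hx
    simpa [sub_eq_zero] using hx.2.1.symm
  · have h := sq_mul_derivative_eval_of_palindromic
      (fun x hx => eulerPoly_palindromic (2 * m - 2) hx) hl0.ne
    rw [hroot, hd, hd] at h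
    have hne : l - l⁻¹ ≠ 0 := sub_ne_zero.2 hlt.ne'
    refine mul_left_cancel₀ hne ?_
    linear_combination h
  · rw [show 2 * m - 1 = 2 * m - 2 + 1 by omega, eulerPoly_succ_eval, hroot, hd]
    ring

/-- Source of the constant `-2^(2m-1)`: it cancels that power in the second coefficient `2^(2m-1) -
2m` of `E`, so the two leading coefficients agree. -/
theorem one_sub_X_pow_sub_quadratic_mul_mem_degreeLT {m : ℕ} (hm : 1 ≤ m) :
    (1 - X) ^ (2 * m) - (X ^ 2 + C (-(2 : ℝ) ^ (2 * m - 1)) * X + 1) * eulerPoly (2 * m - 2)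
      ∈ degreeLT ℝ (2 * m - 1) := by
  set q : ℝ[X] := X ^ 2 + C (-(2 : ℝ) ^ (2 * m - 1)) * X + 1 with hq
  have hq' : q = C 1 * X ^ 2 + C (-(2 : ℝ) ^ (2 * m - 1)) * X + C 1 := by simp [hq]
  have hqd : q.natDegree = 2 := hq' ▸ natDegree_quadratic one_ne_zero
  have hqm : q.Monic := by
    rw [Monic, hq', leadingCoeff_quadratic one_ne_zero]
  have hqn : q.nextCoeff = -(2 : ℝ) ^ (2 * m - 1) := by
    rw [nextCoeff, hqd, hq']; simp [coeff_one, -map_neg, -map_pow]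
  have hp : (1 - X : ℝ[X]) ^ (2 * m) = (X - C 1) ^ (2 * m) := by
    rw [← neg_sub, (even_two_mul m).neg_pow, C_1]
  have hpm : ((X - C (1 : ℝ)) ^ (2 * m)).Monic := (monic_X_sub_C 1).pow _
  have hpd : ((X - C (1 : ℝ)) ^ (2 * m)).natDegree = 2 * m := by
    rw [natDegree_pow, natDegree_X_sub_C, mul_one]
  have hpn : ((X - C (1 : ℝ)) ^ (2 * m)).nextCoeff = -(2 * (m : ℝ)) := by
    rw [(monic_X_sub_C 1).nextCoeff_pow, nextCoeff_X_sub_C]; simp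
  have hrm := hqm.mul (eulerPoly_monic (2 * m - 2))
  have hrd : (q * eulerPoly (2 * m - 2)).natDegree = 2 * m := by
    rw [hqm.natDegree_mul (eulerPoly_monic _), hqd, eulerPoly_natDegree]; omega
  have hrn : (q * eulerPoly (2 * m - 2)).nextCoeff = -(2 * (m : ℝ)) := by
    rw [hqm.nextCoeff_mul (eulerPoly_monic _), hqn, eulerPoly_nextCoeff,
      show 2 * m - 2 + 1 = 2 * m - 1 by omega, Nat.cast_sub (by omega)]
    push_cast; ring
  rw [hp, mem_degreeLT, degree_lt_iff_coeff_zero]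
  intro i hi
  rw [coeff_sub, sub_eq_zero]
  rcases (show i = 2 * m - 1 ∨ i = 2 * m ∨ 2 * m < i by omega) with h | h | h
  · rw [nextCoeff, hpd, if_neg (by omega)] at hpn
    rw [nextCoeff, hrd, if_neg (by omega)] at hrn
    rw [h, hpn, hrn]
  · rw [Monic, leadingCoeff, hpd] at hpm
    rw [Monic, leadingCoeff, hrd] at hrm
    rw [h, hpm, hrm]
  · rw [coeff_eq_zero_of_natDegree_lt (hpd.trans_lt h),
      coeff_eq_zero_of_natDegree_lt (hrd.trans_lt h)]

theorem aeval_analogueSeq {m : ℕ} (hm : 1 ≤ m) :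
    aeval seqShift (X * eulerPoly (2 * m - 2)) (analogueSeq m) =
      aeval seqShift ((1 - X : ℝ[X]) ^ (2 * m)) seqDelta := by
  have hF (l : ℝ) : ∃ F : ℝ[X], l ∈ innerRoots m →
      eulerPoly (2 * m - 2) = (X - C l) * (X - C l⁻¹) * F ∧ F.natDegree + 4 = 2 * m ∧
      l < 0 ∧ -1 < l ∧ F.eval l ≠ 0 ∧ l ^ 2 * F.eval l = l ^ (2 * m - 2) * F.eval l⁻¹ ∧
      (eulerPoly (2 * m - 1)).eval l = l * (1 - l) * ((l - l⁻¹) * F.eval l) := by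
    by_cases hl : l ∈ innerRoots m
    · obtain ⟨F, h⟩ := exists_cofactor hm hl
      exact ⟨F, fun _ => h⟩
    · exact ⟨0, fun h => absurd h hl⟩
  choose F hF using hF
  -- The amplitude is the residue making the partial fraction identity hold at `X = l`.
  have hA (l : ℝ) (hl : l ∈ innerRoots m) :
      analogueAmplitude m l * (l - l⁻¹) * (l ^ 2 * (F l).eval l) = (1 - l) ^ (2 * m) := by
    obtain ⟨-, -, h0, h1, hne, -, hv⟩ := hF l hl
    have h2 : (1 - l) ≠ 0 := by linarith
    have h3 : l - l⁻¹ ≠ 0 := by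
      intro h
      have : l * l = 1 := by
        rw [sub_eq_zero] at h
        nth_rewrite 2 [h]
        exact mul_inv_cancel₀ h0.ne
      nlinarith
    have h4 := h0.ne
    rw [analogueAmplitude, hv, pow_succ]
    generalize l - l⁻¹ = t at *
    field_simp
  have key : (1 - X : ℝ[X]) ^ (2 * m) =
      (X ^ 2 + C (-(2 : ℝ) ^ (2 * m - 1)) * X + 1) * eulerPoly (2 * m - 2)
        + ∑ l ∈ innerRoots m, C (analogueAmplitude m l * (l - l⁻¹)) * (X ^ 2 * F l) := by
    obtain ⟨s, hcard, hE, hs, hinner, -⟩ := eulerPoly_two_mul_sub_two_eq_prod m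
    have hs0 : (0 : ℝ) ∉ s := fun h => (hs 0 h).1.false
    have hroot (x : ℝ) (hx : x ∈ s) : (eulerPoly (2 * m - 2)).eval x = 0 := by
      rw [hE, eval_prod]
      exact Finset.prod_eq_zero hx (by simp)
    rw [← sub_eq_zero, ← sub_sub]
    -- The difference has degree below `2m-1` and vanishes at the `2m-2` roots and at `0`; at a
    -- root, only the summand of its own pair survives.
    refine eq_zero_of_degree_lt_of_eval_finset_eq_zero (insert 0 s) ?_ fun x hx => ?_
    · rw [Finset.card_insert_of_notMem hs0, hcard, show 2 * m - 2 + 1 = 2 * m - 1 by omega,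
        ← mem_degreeLT]
      refine Submodule.sub_mem _ (one_sub_X_pow_sub_quadratic_mul_mem_degreeLT hm)
        (Submodule.sum_mem _ fun l hl => ?_)
      obtain ⟨-, hd, -⟩ := hF l hl
      rw [mem_degreeLT]
      refine lt_of_le_of_lt degree_le_natDegree ?_
      have h1 : (C (analogueAmplitude m l * (l - l⁻¹)) * (X ^ 2 * F l)).natDegree
          ≤ 2 + (F l).natDegree :=
        (natDegree_C_mul_le _ _).trans (natDegree_mul_le.trans (by simp))
      exact_mod_cast h1.trans_lt (by omega)
    · rw [Finset.mem_insert] at hx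
      rcases hx with rfl | hx
      · simp [eval_finsetSum, eulerPoly_eval_zero]
      · have hx0 := (hs x hx).1
        have other (l y : ℝ) (hl : l ∈ innerRoots m) (hy : y ∈ s) (h1 : y ≠ l) (h2 : y ≠ l⁻¹) :
            (F l).eval y = 0 := by
          have h := hroot y hy
          rw [(hF l hl).1] at h
          simpa [sub_eq_zero, h1, h2] using h
        have hsmall (l : ℝ) (hl : l ∈ innerRoots m) : |l| < 1 := by
          rw [hinner, Finset.mem_filter] at hl; exact hl.2
        simp only [eval_sub, eval_mul, hroot x hx, mul_zero, sub_zero, eval_finsetSum, eval_C,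
          eval_pow, eval_X, eval_one]
        rw [sub_eq_zero]
        rcases (hs x hx).2.2.lt_or_gt with h | h
        · have hxi : x ∈ innerRoots m := hinner ▸ Finset.mem_filter.2 ⟨hx, h⟩
          rw [Finset.sum_eq_single_of_mem x hxi, hA x hxi]
          intro l hl hne
          rw [other l x hl hx hne.symm, mul_zero, mul_zero]
          rintro rfl
          have := hsmall l hl
          rw [abs_inv] at h
          exact absurd h ((one_lt_inv₀ (abs_pos.2 (hF l hl).2.2.1.ne)).2 this).le.not_gt
        -- At an outer root the identity follows from that at `1/x`, by the relation between `F` at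
        -- the two points.
        · have hxi : x⁻¹ ∈ innerRoots m := hinner ▸ Finset.mem_filter.2 ⟨(hs x hx).2.1, by
            rw [abs_inv]; exact inv_lt_one_of_one_lt₀ h⟩
          rw [Finset.sum_eq_single_of_mem x⁻¹ hxi]
          · have h1 := hA _ hxi
            obtain ⟨-, -, -, -, hne, hv, -⟩ := hF _ hxi
            rw [hv, inv_inv] at h1
            rw [inv_inv]
            have e : x ^ (2 * m) = x ^ (2 * m - 2) * x ^ 2 := by
              rw [← pow_add]; congr 1; omega
            have e2 : (1 - x) ^ (2 * m) = x ^ (2 * m) * (1 - x⁻¹) ^ (2 * m) := by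
              rw [← mul_pow, mul_sub, mul_inv_cancel₀ hx0.ne, mul_one, ← neg_sub,
                (even_two_mul m).neg_pow]
            rw [e2, ← h1, e, inv_pow]
            have := pow_ne_zero (2 * m - 2) hx0.ne
            field_simp
          · intro l hl hne
            rw [other l x hl hx, mul_zero, mul_zero]
            · rintro rfl
              exact absurd h (hsmall x hl).le.not_gt
            · rintro rfl
              exact hne (inv_inv l).symm
  have hseq : analogueSeq m =
      (fun j : ℤ => if |j| = 1 then 1 else if j = 0 then -(2 : ℝ) ^ (2 * m - 1) else 0) +
      ∑ l ∈ innerRoots m, analogueAmplitude m l • fun j : ℤ => l ^ j.natAbs := by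
    ext j; simp [analogueSeq, Finset.sum_apply]
  have hcentre : seqShift (fun j : ℤ =>
      if |j| = 1 then 1 else if j = 0 then -(2 : ℝ) ^ (2 * m - 1) else 0) =
      aeval seqShift (X ^ 2 + C (-(2 : ℝ) ^ (2 * m - 1)) * X + 1) seqDelta := by
    ext j
    simp only [map_add, map_mul, map_one, map_pow,
      aeval_X, aeval_C, LinearMap.add_apply, Module.End.mul_apply,
      Pi.add_apply, seqShift_pow_apply, Module.End.one_apply, seqShift_apply,
      seqDelta, Module.algebraMap_end_apply, Pi.smul_apply, smul_eq_mul]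
    rcases eq_or_ne j 0 with rfl | h0
    · simp
    rcases eq_or_ne j 1 with rfl | h1
    · simp
    rcases eq_or_ne j 2 with rfl | h2
    · simp
    simp [h0, sub_eq_zero, h1, h2, abs_eq, show j - 1 ≠ -1 by omega, show j - 1 ≠ 1 by omega]
  rw [key, hseq, map_add, map_sum, map_add, LinearMap.add_apply, map_sum, LinearMap.sum_apply]
  congr 1
  · rw [mul_comm X, aeval_mul_seqShift, aeval_X, hcentre, ← aeval_mul_seqShift, mul_comm]
  · refine Finset.sum_congr rfl fun l hl => ?_
    obtain ⟨hE, -, h0, -⟩ := hF l hl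
    rw [map_smul, hE, show X * ((X - C l) * (X - C l⁻¹) * F l) =
      (X * F l) * ((X - C l) * (X - C l⁻¹)) by ring, aeval_mul_seqShift,
      aeval_quadratic_geometric h0.ne, ← aeval_mul_seqShift, ← LinearMap.smul_apply, ← map_smul,
      smul_eq_C_mul, C_mul]
    congr 2
    ring

/-! ### Decay, uniqueness and inversion of the convolution -/

theorem summable_geometric_mul_poly {x : ℝ} (hx : |x| < 1) (hx0 : x ≠ 0) (n : ℕ) :
    Summable fun i : ℤ => x ^ i.natAbs * (1 + |(i : ℝ)|) ^ n := by
  have h : Summable fun i : ℕ => x ^ i * (1 + (i : ℝ)) ^ n := by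
    have := (summable_nat_add_iff (f := fun i : ℕ => (i : ℝ) ^ n * x ^ i) 1).2
      (summable_pow_mul_geometric_of_norm_lt_one n hx)
    refine (this.mul_left x⁻¹).congr fun i => ?_
    rw [pow_succ]
    push_cast
    field_simp
    ring
  exact Summable.of_nat_of_neg (by simpa using h) (by simpa using h)

theorem summable_analogueSeq {m : ℕ} (hm : 1 ≤ m) (n : ℕ) :
    Summable fun i : ℤ => |analogueSeq m i| * (1 + |(i : ℝ)|) ^ n := by
  have h : Summable fun i : ℤ => analogueSeq m i * (1 + |(i : ℝ)|) ^ n := by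
    simp only [analogueSeq, add_mul, Finset.sum_mul]
    refine Summable.add ?_ (summable_sum fun x hx => ?_)
    · refine summable_of_ne_finset_zero (s := {-1, 0, 1}) fun i hi => ?_
      simp only [Finset.mem_insert, Finset.mem_singleton, not_or] at hi
      rw [if_neg (by rw [abs_eq one_pos.le]; tauto), if_neg hi.2.1, zero_mul]
    · obtain ⟨-, -, -, h0, h1, -⟩ := exists_cofactor hm hx
      refine ((summable_geometric_mul_poly (abs_lt.2 ⟨h1, by linarith⟩) h0.ne n).mul_left
        (analogueAmplitude m x)).congr fun i => by ring
  refine h.abs.congr fun i => ?_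
  rw [abs_mul, abs_of_nonneg (a := (1 + |(i : ℝ)|) ^ n) (by positivity)]

theorem HasPolyGrowth.of_bounded {u : ℤ → ℝ} {A : ℝ} (h : ∀ j, |u j| ≤ A) (n : ℕ) :
    HasPolyGrowth n u := by
  refine ⟨A, fun j => (h j).trans (le_mul_of_one_le_right ((abs_nonneg _).trans (h j)) ?_)⟩
  exact one_le_pow₀ (by linarith [abs_nonneg (j : ℝ)])

theorem hasPolyGrowth_analogueSeq {m : ℕ} (hm : 1 ≤ m) (n : ℕ) :
    HasPolyGrowth n (analogueSeq m) := by
  have h := summable_analogueSeq hm 0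
  simp only [pow_zero, mul_one] at h
  exact .of_bounded (fun j => h.le_tsum j fun _ _ => abs_nonneg _) n

theorem eq_of_aeval_X_mul_eulerPoly_eq {m n : ℕ} {u v : ℤ → ℝ} (hu : HasPolyGrowth n u)
    (hv : HasPolyGrowth n v) (h : aeval seqShift (X * eulerPoly (2 * m - 2)) u =
      aeval seqShift (X * eulerPoly (2 * m - 2)) v) : u = v := by
  obtain ⟨s, -, hE, hs, -⟩ := eulerPoly_two_mul_sub_two_eq_prod m
  rw [← sub_eq_zero]
  refine (hu.sub hv).eq_zero_of_aeval_prod_eq_zero (fun x hx => (hs x hx).2.2) ?_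
  rw [← hE]
  rw [← sub_eq_zero, ← map_sub, aeval_mul_seqShift, aeval_X] at h
  ext j
  simpa using congrFun h (j + 1)

theorem abs_seqSignMonomial (m : ℕ) {j : ℤ} (hj : j ≠ 0) :
    |seqSignMonomial m j| = |(j : ℝ)| ^ (2 * m - 1) / 2 := by
  have : |Real.sign (j : ℝ)| = 1 := by
    rcases Real.sign_apply_eq_of_ne_zero (j : ℝ) (by exact_mod_cast hj) with h | h <;> simp [h]
  rw [seqSignMonomial, abs_div, abs_mul, this, abs_pow]; simp

theorem hasPolyGrowth_seqSignMonomial (m : ℕ) :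
    HasPolyGrowth (2 * m - 1) (seqSignMonomial m) := by
  refine ⟨1, fun j => ?_⟩
  rcases eq_or_ne j 0 with rfl | hj
  · simp [seqSignMonomial]
  · rw [abs_seqSignMonomial m hj, one_mul]
    refine (half_le_self (by positivity)).trans ?_
    gcongr
    linarith

theorem seqConv_seqSignMonomial_eq_seqDelta_iff {m : ℕ} (hm : 1 ≤ m) (u : ℤ → ℝ) :
    ((∀ j, Summable fun i => u i * seqSignMonomial m (j - i)) ∧
      seqConv u (seqSignMonomial m) = seqDelta) ↔ u = analogueSeq m := by
  constructor
  · rintro ⟨hs, hu⟩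
    -- Absolute summability at `j = 0` bounds `u`, since the kernel is at least `1/2` in modulus off
    -- the origin; it vanishes at the origin, hence the extra `|u 0|`.
    have hb : HasPolyGrowth 0 u := by
      have h0 := (hs 0).abs
      refine .of_bounded (A := 2 * ∑' i, |u i * seqSignMonomial m (0 - i)| + |u 0|) (fun j => ?_) 0
      have h1 := h0.le_tsum j fun _ _ => abs_nonneg _
      rcases eq_or_ne j 0 with rfl | hj
      · linarith [abs_nonneg (u 0 * seqSignMonomial m (0 - 0))]
      · rw [abs_mul, zero_sub, abs_seqSignMonomial m (neg_ne_zero.2 hj)] at h1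
        have h2 : 1 ≤ |((-j : ℤ) : ℝ)| ^ (2 * m - 1) := by
          refine one_le_pow₀ ?_
          have := Int.one_le_abs (neg_ne_zero.2 hj)
          exact_mod_cast this
        nlinarith [abs_nonneg (u j), abs_nonneg (u 0)]
    refine eq_of_aeval_X_mul_eulerPoly_eq (m := m) hb (hasPolyGrowth_analogueSeq hm 0) ?_
    rw [aeval_analogueSeq hm, ← hu, aeval_seqShift_seqConv _ hs,
      one_sub_shift_pow_seqSignMonomial hm, ← aeval_seqShift_seqConv, seqConv_seqDelta]
    exact fun j => summable_mul_seqDelta u j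
  · rintro rfl
    obtain ⟨hs, hg⟩ := hasPolyGrowth_seqConv (summable_analogueSeq hm (2 * m - 1))
      (hasPolyGrowth_seqSignMonomial m)
    refine ⟨hs, eq_of_aeval_X_mul_eulerPoly_eq (m := m) hg
      (.of_bounded (A := 1) (fun j => ?_) _) ?_⟩
    · unfold seqDelta; split_ifs <;> simp
    -- `S E(S)` is moved onto the analogue, becomes `(1-S)^(2m) δ`, and that power then acts on the
    -- kernel.
    rw [seqConv_comm, aeval_seqShift_seqConv _ fun j => summable_mul_comp_sub_comm (hs j),
      aeval_analogueSeq hm, ← aeval_seqShift_seqConv _ (summable_mul_seqDelta _),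
      seqConv_seqDelta, one_sub_shift_pow_seqSignMonomial hm]

theorem latticeG_eq (m : ℕ) {h : ℝ} (hh : 0 < h) (β : ℤ) : latticeG m h β =
    h ^ (2 * m - 1) / (2 * m - 1).factorial * seqSignMonomial m β := by
  have : Real.sign (h * β) = Real.sign β := by
    rcases lt_trichotomy (β : ℝ) 0 with hb | hb | hb
    · rw [Real.sign_of_neg hb, Real.sign_of_neg (mul_neg_of_pos_of_neg hh hb)]
    · rw [hb, mul_zero]
    · rw [Real.sign_of_pos hb, Real.sign_of_pos (mul_pos hh hb)]
  rw [latticeG, seqSignMonomial, this, mul_pow]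
  field_simp

/-- Since `h G_m` is `c = h^(2m) / (2m-1)!` times the normalized kernel, `c D` must be its
convolution inverse. -/
theorem isDiscreteAnalogue_iff {m : ℕ} (hm : 1 ≤ m) {h : ℝ} (hh : 0 < h) (D : ℤ → ℝ) :
    IsDiscreteAnalogue m h D ↔
      ∀ β, D β = ((2 * m - 1).factorial : ℝ) / h ^ (2 * m) * analogueSeq m β := by
  set c : ℝ := h ^ (2 * m) / (2 * m - 1).factorial with hc
  have hc0 : c ≠ 0 := by positivity
  have hcinv : ((2 * m - 1).factorial : ℝ) / h ^ (2 * m) = c⁻¹ := by rw [hc, inv_div]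
  have hterm (β γ : ℤ) : D γ * latticeG m h (β - γ) =
      h⁻¹ * ((c • D) γ * seqSignMonomial m (β - γ)) := by
    have e : h ^ (2 * m) = h ^ (2 * m - 1) * h := by rw [← pow_succ]; congr 1; omega
    rw [latticeG_eq m hh, Pi.smul_apply, smul_eq_mul, hc, e]
    field_simp
  have h1 : IsDiscreteAnalogue m h D ↔
      ((∀ j, Summable fun i => (c • D) i * seqSignMonomial m (j - i)) ∧
        seqConv (c • D) (seqSignMonomial m) = seqDelta) := by
    unfold IsDiscreteAnalogue
    simp only [hterm, summable_mul_left_iff (inv_ne_zero hh.ne'), tsum_mul_left,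
      mul_inv_cancel_left₀ hh.ne', forall_and, funext_iff]
    rfl
  rw [h1, seqConv_seqSignMonomial_eq_seqDelta_iff hm, funext_iff, hcinv]
  refine forall_congr' fun β => ?_
  rw [Pi.smul_apply, smul_eq_mul, eq_inv_mul_iff_mul_eq₀ hc0]

theorem theorem1 (m : ℕ) (hm : 1 ≤ m) :
    -- there are exactly `m - 1` roots of modulus less than one, all of them real,
    -- and the denominators below do not vanish
    (innerRoots m).card = m - 1 ∧
    (∀ z : ℂ, Polynomial.aeval z (eulerPoly (2 * m - 2)) = 0 → ‖z‖ < 1 →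
      ∃ x ∈ innerRoots m, z = (x : ℂ)) ∧
    (∀ x ∈ innerRoots m, x ≠ 0 ∧ (eulerPoly (2 * m - 1)).eval x ≠ 0) ∧
    -- the discrete analogue exists, is unique, and is given by the closed formula
    ∀ (h : ℝ), 0 < h → ∀ D : ℤ → ℝ, IsDiscreteAnalogue m h D ↔
      ∀ β : ℤ, D β = ((2 * m - 1).factorial : ℝ) / h ^ (2 * m) *
        (if 2 ≤ |β| then
          ∑ x ∈ innerRoots m, (1 - x) ^ (2 * m + 1) * x ^ β.natAbs /
            (x * (eulerPoly (2 * m - 1)).eval x)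
        else if |β| = 1 then
          1 + ∑ x ∈ innerRoots m, (1 - x) ^ (2 * m + 1) / (eulerPoly (2 * m - 1)).eval x
        else
          -(2 : ℝ) ^ (2 * m - 1) + ∑ x ∈ innerRoots m, (1 - x) ^ (2 * m + 1) /
            (x * (eulerPoly (2 * m - 1)).eval x)) := by
  obtain ⟨s, -, hE, hs, hinner, hcard⟩ := eulerPoly_two_mul_sub_two_eq_prod m
  have hne (x : ℝ) (hx : x ∈ innerRoots m) :
      x ≠ 0 ∧ (eulerPoly (2 * m - 1)).eval x ≠ 0 := by
    obtain ⟨F, -, -, h0, h1, hF, -, hv⟩ := exists_cofactor hm hx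
    refine ⟨h0.ne, ?_⟩
    rw [hv]
    have h2 : x - x⁻¹ ≠ 0 := by
      have : x * (x - x⁻¹) = x * x - 1 := by rw [mul_sub, mul_inv_cancel₀ h0.ne]
      intro h
      rw [h] at this
      nlinarith
    exact mul_ne_zero (mul_ne_zero h0.ne (by linarith)) (mul_ne_zero h2 hF)
  refine ⟨hcard, fun z hz hz1 => ?_, hne, fun h hh D => ?_⟩
  -- `E` splits over the reals, so every complex root is real.
  · rw [hE, map_prod, Finset.prod_eq_zero_iff] at hz
    obtain ⟨x, hx, hzx⟩ := hz
    have hzx : z = x := by simpa [sub_eq_zero] using hzx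
    refine ⟨x, hinner ▸ Finset.mem_filter.2 ⟨hx, ?_⟩, hzx⟩
    simpa [hzx] using hz1
  · rw [isDiscreteAnalogue_iff hm hh]
    refine forall_congr' fun β => ?_
    rw [analogueSeq]
    have hA (k : ℕ) (x : ℝ) : (1 - x) ^ (2 * m + 1) * x ^ k /
        (x * (eulerPoly (2 * m - 1)).eval x) = analogueAmplitude m x * x ^ k := by
      rw [analogueAmplitude]; ring
    rcases eq_or_ne β 0 with rfl | h0
    · simp [analogueAmplitude]
    rcases eq_or_ne |β| 1 with h1 | h1
    · have hβ : β.natAbs = 1 := by rw [Int.abs_eq_natAbs] at h1; exact_mod_cast h1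
      rw [if_pos h1, if_neg (by rw [h1]; norm_num), if_pos h1, hβ]
      congr! 4 with x hx
      obtain ⟨hx0, -⟩ := hne x hx
      rw [analogueAmplitude, pow_one]
      field_simp
    · have h2 : 2 ≤ |β| := by
        have := abs_pos.2 h0
        omega
      simp only [if_neg h1, if_neg h0, if_pos h2, zero_add, hA]
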